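/- Let $T$ be a finite tree with at least two vertices, $V(T)$ its vertex set, and $d$ the distance in $T$. A set $S\subseteq V(T)$ is a *resolving set* if for all distinct $x,y\in V(T)$ there is $z\in S$ with $d(x,z)\neq d(y,z)$; it is a *connected resolving set* if moreover the subgraph induced by $S$ is connected. Let $\mathrm{cdim}(T)$ be the minimum cardinality of a connected resolving set of $T$, and, for $v\in V(T)$, let $\mathrm{cdim}_T(v)$ be the minimum cardinality of a connected resolving set of $T$ that contains $v$. An *end vertex* is a vertex of degree $1$, and $\sigma(T)$ is the number of end vertices. A *major vertex* is a vertex of degree at least $3$. An end vertex $\ell$ is a *terminal vertex* of a major vertex $w$ if $d(\ell,w)<d(\ell,w')$ for every other major vertex $w'$; the *terminal degree* of $w$ is the number of its terminal vertices. Let $\mathcal M(T)$ be the set of major vertices of positive terminal degree, and let $\mathcal M_1(T)$ and $\mathcal M_2(T)$ be the subsets of those of terminal degree $1$ and of terminal degree at least $2$, respectively. For $w\in\mathcal M(T)$ let $T_w$ be the subtree induced by $w$ and all vertices on the paths joining $w$ with its terminal vertices; for $i=1,2$ put $V(\mathcal T_i)=\bigcup_{w\in\mathcal M_i(T)}V(T_w)$.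 An *interior degree-two vertex* is a vertex of degree $2$ such that the shortest path from it to any terminal vertex (of any major vertex) includes a major vertex. Let $\mathcal D$ be the set of all interior degree-two vertices and all major vertices of terminal degree $0$, and let $$\Gamma=\bigcup_{w\in\mathcal M_2(T)}\bigl(N[w]\cap V(T_w)\bigr)\cup\mathcal M_1(T)\cup\mathcal D,$$ where $N[w]$ is the closed neighbourhood of $w$. (a) If $T$ is a path, then $\mathrm{cdim}(T)=1$; if $T$ is not a path, then $\mathrm{cdim}(T)=|\mathcal D|+\sigma(T)$. (b) Let $v\in V(T)$. If $\mathcal M(T)=\emptyset$, then $\mathrm{cdim}_T(v)=1$ if $v$ is an end vertex, and $\mathrm{cdim}_T(v)=2$ otherwise. If $\mathcal M(T)\neq\emptyset$, then $v\in\Gamma\cup V(\mathcal T_1)\cup V(\mathcal T_2)$, and $$\mathrm{cdim}_T(v)=\begin{cases}|\mathcal D|+\sigma(T) & \text{if } v\in\Gamma,\\ |\mathcal D|+\sigma(T)+d(v,u) & \text{if } v\in V(\mathcal T_1)\setminus\Gamma,\\ |\mathcal D|+\sigma(T)+d(v,u)-1 & \text{if } v\in V(\mathcal T_2)\setminus\Gamma,\end{cases}$$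 where $u$ is the major vertex nearest to $v$. -/

import Mathlib

/-!
Connected metric dimension of a graph, and the decomposition of a finite graph into major vertices,
terminal vertices and legs.  All graphs to which these notions are applied are finite and connected.
-/

namespace ConnMetricDim

variable {V : Type*}

/-- A vertex `z` resolves the pair `x, y` if its distances to `x` and to `y` differ. -/
def Resolves (G : SimpleGraph V) (z x y : V) : Prop :=
  G.dist x z ≠ G.dist y z

/-- Every two distinct vertices are resolved by some vertex of `S`. -/
def IsResolvingSet (G : SimpleGraph V) (S : Set V) : Prop :=
  ∀ x y : V, x ≠ y → ∃ z ∈ S, Resolves G z x y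

/-- A resolving set that induces a connected subgraph. -/
def IsConnectedResolvingSet (G : SimpleGraph V) (S : Set V) : Prop :=
  IsResolvingSet G S ∧ (G.induce S).Connected

/-- The connected metric dimension `cdim(G)`: the minimum cardinality of a connected resolving set.
(For a finite connected graph the whole vertex set is such a set, so the minimum exists.) -/
noncomputable def cdim (G : SimpleGraph V) : ℕ :=
  sInf {k | ∃ S : Set V, IsConnectedResolvingSet G S ∧ S.ncard = k}

/-- The connected metric dimension `cdim_G(v)` at `v`: the minimum cardinality of a connected
resolving set that contains `v`. -/
noncomputable def cdimAt (G : SimpleGraph V) (v : V) : ℕ :=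
  sInf {k | ∃ S : Set V, IsConnectedResolvingSet G S ∧ v ∈ S ∧ S.ncard = k}

/-- `G` is a path, that is, isomorphic to some path graph `P_n`. -/
def IsPathGraph (G : SimpleGraph V) : Prop :=
  ∃ n : ℕ, Nonempty (G ≃g SimpleGraph.pathGraph n)

section Finite

variable [Fintype V] (G : SimpleGraph V) [DecidableRel G.Adj]

/-- An end vertex (leaf): a vertex of degree one. -/
def IsEndVertex (v : V) : Prop := G.degree v = 1

/-- A major vertex: a vertex of degree at least three. -/
def IsMajor (v : V) : Prop := 3 ≤ G.degree v

/-- `l` is a terminal vertex of the major vertex `v`: an end vertex that is strictly closer to `v`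
than to every other major vertex. -/
def IsTerminalVertexOf (l v : V) : Prop :=
  IsEndVertex G l ∧ IsMajor G v ∧ ∀ w, IsMajor G w → w ≠ v → G.dist l v < G.dist l w

/-- The terminal degree of `v`: the number of its terminal vertices. -/
noncomputable def terminalDegree (v : V) : ℕ :=
  {l | IsTerminalVertexOf G l v}.ncard

/-- `σ(G)`: the number of end vertices. -/
noncomputable def numEndVertices : ℕ :=
  {l | IsEndVertex G l}.ncard

/-- The exterior major vertices: the major vertices of positive terminal degree. -/
def exteriorMajor : Set V := {v | IsMajor G v ∧ 0 < terminalDegree G v}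

/-- The exterior major vertices of terminal degree one. -/
def exteriorMajorOne : Set V := {v | v ∈ exteriorMajor G ∧ terminalDegree G v = 1}

/-- The exterior major vertices of terminal degree at least two. -/
def exteriorMajorTwo : Set V := {v | v ∈ exteriorMajor G ∧ 2 ≤ terminalDegree G v}

/-- An interior degree-two vertex: a vertex of degree two such that every shortest path from it to
any terminal vertex (of any major vertex) includes a major vertex. -/
def IsInteriorDegreeTwo (v : V) : Prop :=
  G.degree v = 2 ∧
    ∀ l, (∃ w, IsTerminalVertexOf G l w) →
      ∀ p : G.Walk v l, p.IsPath → p.length = G.dist v l → ∃ x ∈ p.support, IsMajor G x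

/-- The interior degree-two vertices together with the major vertices of terminal degree zero. -/
def interiorSet : Set V :=
  {v | IsInteriorDegreeTwo G v ∨ (IsMajor G v ∧ terminalDegree G v = 0)}

/-- The vertex set of `T_v`: the vertex `v` and all vertices on the paths that join `v` with its
terminal vertices. -/
def legSet (v : V) : Set V :=
  {x | x = v ∨ ∃ l, IsTerminalVertexOf G l v ∧ ∃ p : G.Walk v l, p.IsPath ∧ x ∈ p.support}

/-- The union of the sets `V(T_w)` over the exterior major `w` of terminal degree one. -/
def legsOne : Set V := {x | ∃ w ∈ exteriorMajorOne G, x ∈ legSet G w}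

/-- The union of the sets `V(T_w)` over the exterior major `w` of terminal degree at least two. -/
def legsTwo : Set V := {x | ∃ w ∈ exteriorMajorTwo G, x ∈ legSet G w}

/-- The set `Γ`: the closed neighbourhood of `w` within `T_w` for each exterior major `w` of terminal
degree at least two, the exterior major vertices of terminal degree one, and the interior set. -/
def coreSet : Set V :=
  {x | ∃ w ∈ exteriorMajorTwo G, (x = w ∨ G.Adj w x) ∧ x ∈ legSet G w} ∪
    exteriorMajorOne G ∪ interiorSet G

/-- `u` is a major vertex nearest to `v`. -/
def IsNearestMajor (v u : V) : Prop :=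
  IsMajor G u ∧ ∀ w, IsMajor G w → G.dist v u ≤ G.dist v w

end Finite

end ConnMetricDim

/-!
In a tree, every question about distances reduces to directions: a vertex `x` other than `p` is seen
from `p` through exactly one neighbour of `p` (`toward_unique`), and if `x` and `y` are seen through
different neighbours, then `p` lies on the path between them (`betw_of_toward_ne`). Two vertices at
the same distance from `s` part ways at some vertex `m` of their common geodesic, and `m` is `s` or a
major vertex (`exists_branching_isMajor`). Connected vertex sets are the geodesically convex ones
(`induce_connected_iff`).

For a tree with a major vertex this shows what the connected resolving sets are: the nonempty
geodesically convex sets that contain all major vertices and miss at most one neighbour of each of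
them. Indeed, a resolving set meets all but at most one of the branches at any vertex
(`IsResolvingSet.eq_of_not_toward`), so a convex one contains each major vertex, and also each
interior vertex of degree two, since there both branches contain major vertices. Conversely, two
vertices at the same distance from a major vertex part ways at a major vertex `m`, and one of the two
neighbours of `m` through which they leave lies in the set and resolves them
(`isResolvingSet_of_isMajor_subset`).

It remains to count. The vertex set is the disjoint union of the major vertices, the interior vertices
of degree two, and one leg for each end vertex (`isMajor_or_interior_or_mem_leg`, `eq_of_mem_leg`), so
the size of a set that contains the first two parts is determined by the numbers of its vertices on
the legs (`ncard_eq_trunk_add_sum`). A connected resolving set avoids at most one leg at each exterior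
major vertex; hence these numbers add up to at least `σ(T) - |M(T)|`, which together with the
`|D| + |M(T)|` vertices outside the legs gives `|D| + σ(T)`. A vertex `v` on the leg at `w` forces
`d(v, w)` vertices on that leg, and the leg may still not be the one avoided only if `w` has another.
Pruning the legs of the tree to the prescribed lengths (`prunedSet`) attains these bounds.
-/

namespace ConnMetricDim

open SimpleGraph

section Geodesics

variable {V : Type*} {T : SimpleGraph V}

/-! ### Geodesics and directions in a tree -/

/-- The vertex `z` lies on a geodesic from `x` to `y`. -/
def Betw (T : SimpleGraph V) (x z y : V) : Prop :=
  T.dist x z + T.dist z y = T.dist x y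

/-- The neighbour `a` of `p` is one step closer to `x`; in a tree it names the branch at `p` that
contains `x`. -/
def Toward (T : SimpleGraph V) (p x a : V) : Prop :=
  T.Adj p a ∧ T.dist p x = T.dist a x + 1

lemma Betw.symm {x z y : V} (h : Betw T x z y) : Betw T y z x := by
  unfold Betw at *
  rw [T.dist_comm (u := y) (v := z), T.dist_comm (u := z) (v := x), T.dist_comm (u := y) (v := x)]
  omega

lemma betw_iff_le (hc : T.Connected) {x z y : V} :
    Betw T x z y ↔ T.dist x z + T.dist z y ≤ T.dist x y :=
  ⟨fun h => h.le, fun h => le_antisymm h hc.dist_triangle⟩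

lemma betw_right (x y : V) : Betw T x y y := by simp [Betw]

lemma Betw.trans_right (hc : T.Connected) {x z y u : V} (h : Betw T x z y) (hu : Betw T z u y) :
    Betw T x u y ∧ Betw T x z u := by
  unfold Betw at *
  have h1 := hc.dist_triangle (u := x) (v := z) (w := u)
  have h2 := hc.dist_triangle (u := x) (v := u) (w := y)
  omega

lemma Betw.trans_left (hc : T.Connected) {x z y u : V} (h : Betw T x z y) (hu : Betw T x u z) :
    Betw T x u y ∧ Betw T u z y := by
  obtain ⟨h1, h2⟩ := h.symm.trans_right hc hu.symm
  exact ⟨h1.symm, h2.symm⟩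

lemma dist_eq_one_of_adj {p a : V} (h : T.Adj p a) : T.dist p a = 1 :=
  SimpleGraph.dist_eq_one_iff_adj.2 h

lemma Toward.betw {p x a : V} (h : Toward T p x a) : Betw T p a x := by
  have := dist_eq_one_of_adj h.1
  have := h.2
  unfold Betw
  omega

lemma Toward.ne {p x a : V} (h : Toward T p x a) : p ≠ x := by
  rintro rfl
  simpa using h.2

lemma toward_of_adj {p a : V} (h : T.Adj p a) : Toward T p a a := by
  refine ⟨h, ?_⟩
  simp [dist_eq_one_of_adj h]

lemma toward_iff_betw {p x a : V} (h : T.Adj p a) : Toward T p x a ↔ Betw T p a x := by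
  refine ⟨Toward.betw, fun hb => ⟨h, ?_⟩⟩
  unfold Betw at hb
  rw [dist_eq_one_of_adj h] at hb
  omega

lemma exists_toward (hc : T.Connected) {p x : V} (h : p ≠ x) : ∃ a, Toward T p x a := by
  obtain ⟨q, hq⟩ := hc.exists_walk_length_eq_dist p x
  cases q with
  | nil => exact absurd rfl h
  | @cons _ a _ hadj q =>
    refine ⟨a, hadj, ?_⟩
    rw [Walk.length_cons] at hq
    have h1 := SimpleGraph.dist_le q
    have h2 := hc.dist_triangle (u := p) (v := a) (w := x)
    rw [dist_eq_one_of_adj hadj] at h2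
    omega

/-- A branch at `p` is determined by any of its vertices: paths in a tree are unique. -/
lemma toward_unique (hT : T.IsTree) {p x a b : V} (ha : Toward T p x a) (hb : Toward T p x b) :
    a = b := by
  obtain ⟨q, hq⟩ := hT.1.exists_walk_length_eq_dist a x
  obtain ⟨r, hr⟩ := hT.1.exists_walk_length_eq_dist b x
  have h1 : (Walk.cons ha.1 q).IsPath :=
    Walk.isPath_of_length_eq_dist _ (by rw [Walk.length_cons, hq, ha.2])
  have h2 : (Walk.cons hb.1 r).IsPath :=
    Walk.isPath_of_length_eq_dist _ (by rw [Walk.length_cons, hr, hb.2])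
  have h3 := (hT.existsUnique_path p x).unique h1 h2
  simpa using congrArg (fun w => w.getVert 1) h3

lemma dist_of_not_toward (hT : T.IsTree) {p x a : V} (h : T.Adj p a) (hn : ¬ Toward T p x a) :
    T.dist a x = T.dist p x + 1 := by
  have h1 := hT.dist_eq_dist_add_one_of_adj x h
  rw [T.dist_comm (u := x) (v := p), T.dist_comm (u := x) (v := a)] at h1
  rcases h1 with h1 | h1
  · exact absurd ⟨h, h1⟩ hn
  · exact h1

/-- A vertex that is left in two different directions separates its targets. -/
lemma betw_of_toward_ne (hT : T.IsTree) {p x y a b : V} (ha : Toward T p x a)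
    (hb : Toward T p y b) (hab : a ≠ b) : Betw T x p y := by
  induction hn : T.dist p y generalizing y with
  | zero => exact absurd (hT.1.dist_eq_zero_iff.1 hn) hb.ne
  | succ n ih =>
    obtain ⟨y', hy'⟩ := exists_toward hT.1 hb.ne.symm
    have hd : T.dist p y' = n := by
      have := hy'.2
      rw [T.dist_comm, hn, T.dist_comm (u := y')] at this
      omega
    have hxy' : Betw T x p y' := by
      by_cases hpy : p = y'
      · subst hpy
        exact betw_right _ _
      · obtain ⟨c, hc⟩ := exists_toward hT.1 hpy
        have hcy : Toward T p y c := by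
          refine ⟨hc.1, ?_⟩
          have h1 := hc.2
          have h2 := hT.1.dist_triangle (u := c) (v := y') (w := y)
          have h3 := hT.1.dist_triangle (u := p) (v := c) (w := y)
          rw [dist_eq_one_of_adj hy'.1.symm] at h2
          rw [dist_eq_one_of_adj hc.1] at h3
          omega
        have hcb := toward_unique hT hcy hb
        subst hcb
        exact ih hc hd
    by_cases hyx : Toward T y' x y
    · -- `y` would be the first step from `y'` towards `x`, but that step leads towards `p`
      exfalso
      by_cases hpy : p = y'
      · subst hpy
        exact hab ((toward_unique hT ha hyx).trans
          (toward_unique hT (toward_of_adj hy'.1.symm) hb))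
      · obtain ⟨q, hq⟩ := exists_toward hT.1 (Ne.symm hpy)
        have hqx : Toward T y' x q :=
          (toward_iff_betw hq.1).2 ((hxy'.symm.trans_left hT.1 hq.betw).1)
        have hqy := toward_unique hT hqx hyx
        subst hqy
        have h1 := hq.2
        have h2 := hy'.2
        omega
    · have h1 := dist_of_not_toward hT hy'.1.symm hyx
      unfold Betw at *
      rw [T.dist_comm (u := x) (v := y), h1, T.dist_comm (u := y') (v := x)]
      omega

lemma toward_of_not_betw (hT : T.IsTree) {p x y a : V} (hy : p ≠ y) (ha : Toward T p x a)
    (h : ¬ Betw T x p y) : Toward T p y a := by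
  obtain ⟨b, hb⟩ := exists_toward hT.1 hy
  by_cases hab : a = b
  · exact hab ▸ hb
  · exact absurd (betw_of_toward_ne hT ha hb hab) h

lemma toward_of_betw (hT : T.IsTree) {w l x n : V} (hne : x ≠ w) (hx : Betw T w x l)
    (hn : Toward T w l n) : Toward T w x n := by
  obtain ⟨a, ha⟩ := exists_toward hT.1 hne.symm
  have : a = n := toward_unique hT ((toward_iff_betw ha.1).2 (hx.trans_left hT.1 ha.betw).1) hn
  exact this ▸ ha

/-- A geodesic in a tree contains at most one vertex at each distance from its start. -/
lemma betw_unique (hT : T.IsTree) {w l x y : V} (hx : Betw T w x l) (hy : Betw T w y l)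
    (h : T.dist w x = T.dist w y) : x = y := by
  induction hn : T.dist w x generalizing x y with
  | zero =>
    rw [hn] at h
    exact (hT.1.dist_eq_zero_iff.1 hn).symm.trans (hT.1.dist_eq_zero_iff.1 h.symm)
  | succ n ih =>
    have key : ∀ z, Betw T w z l → T.dist w z = n + 1 →
        ∃ z', Betw T w z' l ∧ T.dist w z' = n ∧ Toward T z' l z := by
      intro z hz hzn
      have hne : z ≠ w := by
        rintro rfl
        simp at hzn
      obtain ⟨z', hz'⟩ := exists_toward hT.1 hne
      obtain ⟨h1, h2⟩ := hz.trans_left hT.1 hz'.betw.symm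
      refine ⟨z', h1, ?_, (toward_iff_betw hz'.1.symm).2 h2⟩
      have := hz'.2
      rw [T.dist_comm, hzn, T.dist_comm (u := z')] at this
      omega
    obtain ⟨x', h1, h2, h3⟩ := key x hx hn
    obtain ⟨y', h4, h5, h6⟩ := key y hy (h ▸ hn)
    have := ih h1 h4 (h2.trans h5.symm) h2
    subst this
    exact toward_unique hT h3 h6

lemma exists_betw_dist_eq (hc : T.Connected) (w l : V) {k : ℕ} (hk : k ≤ T.dist w l) :
    ∃ x, Betw T w x l ∧ T.dist w x = k := by
  induction k with
  | zero => exact ⟨w, by simp [Betw], by simp⟩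
  | succ k ih =>
    obtain ⟨x, hx, hxk⟩ := ih (by omega)
    have hne : x ≠ l := by
      rintro rfl
      omega
    obtain ⟨a, ha⟩ := exists_toward hc hne
    obtain ⟨h1, h2⟩ := hx.trans_right hc ha.betw
    refine ⟨a, h1, ?_⟩
    unfold Betw at h2
    rw [dist_eq_one_of_adj ha.1] at h2
    omega

/-- The point where the geodesics from `s` to two vertices at the same distance diverge. -/
lemma exists_branching (hT : T.IsTree) {s x y : V} (hxy : x ≠ y)
    (h : T.dist s x = T.dist s y) :
    ∃ m b c, Betw T s m x ∧ Betw T s m y ∧ Toward T m x b ∧ Toward T m y c ∧ b ≠ c := by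
  induction hn : T.dist s x generalizing s with
  | zero =>
    rw [hn] at h
    exact absurd ((hT.1.dist_eq_zero_iff.1 hn).symm.trans (hT.1.dist_eq_zero_iff.1 h.symm)) hxy
  | succ n ih =>
    have hsx : s ≠ x := by
      rintro rfl
      simp at hn
    have hsy : s ≠ y := by
      rintro rfl
      simp [hn] at h
    obtain ⟨b, hb⟩ := exists_toward hT.1 hsx
    obtain ⟨c, hc⟩ := exists_toward hT.1 hsy
    by_cases hbc : b = c
    · subst hbc
      have h1 := hb.2
      have h2 := hc.2
      obtain ⟨m, b', c', h3, h4, h5⟩ := ih (s := b) (by omega) (by omega)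
      exact ⟨m, b', c', (hb.betw.trans_right hT.1 h3).1, (hc.betw.trans_right hT.1 h4).1, h5⟩
    · exact ⟨s, b, c, by simp [Betw], by simp [Betw], hb, hc, hbc⟩

/-! ### Connected vertex sets are the geodesically convex ones -/

/-- A set of vertices that contains every geodesic between two of its members. -/
def GeodConvex (T : SimpleGraph V) (S : Set V) : Prop :=
  ∀ x ∈ S, ∀ y ∈ S, ∀ z, Betw T x z y → z ∈ S

lemma exists_isPath_mem_support_iff (hT : T.IsTree) {x y z : V} :
    (∃ p : T.Walk x y, p.IsPath ∧ z ∈ p.support) ↔ Betw T x z y := by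
  constructor
  · rintro ⟨p, hp, hz⟩
    obtain ⟨r, hr⟩ := hT.1.exists_walk_length_eq_dist x y
    have hpr := (hT.existsUnique_path x y).unique hp (r.isPath_of_length_eq_dist hr)
    subst hpr
    classical
    rw [betw_iff_le hT.1, ← hr, ← p.take_spec hz, Walk.length_append]
    exact add_le_add (SimpleGraph.dist_le _) (SimpleGraph.dist_le _)
  · intro h
    obtain ⟨q, hq⟩ := hT.1.exists_walk_length_eq_dist x z
    obtain ⟨r, hr⟩ := hT.1.exists_walk_length_eq_dist z y
    refine ⟨q.append r, Walk.isPath_of_length_eq_dist _ ?_, by simp⟩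
    rw [Walk.length_append, hq, hr]
    exact h

lemma induce_connected_iff (hT : T.IsTree) {S : Set V} :
    (T.induce S).Connected ↔
      S.Nonempty ∧ GeodConvex T S := by
  classical
  constructor
  · intro h
    refine ⟨Set.nonempty_coe_sort.1 h.nonempty, fun x hx y hy z hz => ?_⟩
    obtain ⟨p, hp⟩ := h.preconnected.exists_isPath ⟨x, hx⟩ ⟨y, hy⟩
    have hp' : (p.map (Embedding.induce S).toHom).IsPath :=
      hp.map (Embedding.induce (G := T) S).injective
    obtain ⟨q, hq, hzq⟩ := (exists_isPath_mem_support_iff hT).2 hz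
    have hpq := (hT.existsUnique_path x y).unique hq hp'
    subst hpq
    obtain ⟨a, -, rfl⟩ := List.mem_map.1 ((Walk.support_map _ _) ▸ hzq)
    exact a.2
  · rintro ⟨hne, hconv⟩
    have := hne.to_subtype
    refine ⟨fun x y => ?_⟩
    obtain ⟨p, hp⟩ := hT.1.exists_walk_length_eq_dist x.1 y.1
    have hS : ∀ z ∈ p.support, z ∈ S := fun z hz =>
      hconv x x.2 y y.2 z ((exists_isPath_mem_support_iff hT).1
        ⟨p, p.isPath_of_length_eq_dist hp, hz⟩)
    exact ⟨p.induce S hS⟩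

end Geodesics

section Legs

variable {V : Type*} {T : SimpleGraph V} [Fintype V] [DecidableRel T.Adj]

/-! ### Degrees -/

lemma isMajor_of_adj {m a b c : V} (ha : T.Adj m a) (hb : T.Adj m b) (hc : T.Adj m c)
    (hab : a ≠ b) (hac : a ≠ c) (hbc : b ≠ c) : IsMajor T m := by
  unfold IsMajor
  rw [← T.card_neighborFinset_eq_degree]
  exact Finset.two_lt_card.2 ⟨a, by simpa, b, by simpa, c, by simpa, hab, hac, hbc⟩

lemma exists_adj_ne_of_isMajor {m : V} (h : IsMajor T m) (a : V) :
    ∃ b c, T.Adj m b ∧ T.Adj m c ∧ b ≠ a ∧ c ≠ a ∧ b ≠ c := by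
  unfold IsMajor at h
  rw [← T.card_neighborFinset_eq_degree] at h
  classical
  have h1 : 1 < ((T.neighborFinset m).erase a).card := by
    have := Finset.pred_card_le_card_erase (s := T.neighborFinset m) (a := a)
    omega
  obtain ⟨b, hb, c, hc, hbc⟩ := Finset.one_lt_card.1 h1
  simp only [Finset.mem_erase, mem_neighborFinset] at hb hc
  exact ⟨b, c, hb.2, hc.2, hb.1, hc.1, hbc⟩

lemma IsEndVertex.adj_unique {l a b : V} (h : IsEndVertex T l) (ha : T.Adj l a)
    (hb : T.Adj l b) : a = b := by
  unfold IsEndVertex at h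
  rw [← T.card_neighborFinset_eq_degree] at h
  exact Finset.card_le_one.1 h.le a (by simpa) b (by simpa)

lemma IsEndVertex.not_isMajor {l : V} (h : IsEndVertex T l) : ¬ IsMajor T l := by
  unfold IsEndVertex at h
  unfold IsMajor
  omega

lemma one_le_degree [Nontrivial V] (hc : T.Connected) (v : V) : 1 ≤ T.degree v := by
  obtain ⟨x, hx⟩ := exists_ne v
  obtain ⟨a, ha⟩ := exists_toward hc hx.symm
  exact (T.degree_pos_iff_exists_adj v).2 ⟨a, ha.1⟩

lemma exists_adj_ne_of_two_le_degree {v : V} (h : 2 ≤ T.degree v) (a : V) :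
    ∃ b, T.Adj v b ∧ b ≠ a := by
  rw [← T.card_neighborFinset_eq_degree] at h
  obtain ⟨b, hb, hba⟩ := Finset.exists_mem_ne h a
  exact ⟨b, by simpa using hb, hba⟩

/-- Two vertices at the same distance from `s` force a vertex of degree at least three, unless
they are seen from `s` in different directions. -/
lemma exists_branching_isMajor (hT : T.IsTree) {s x y : V} (hxy : x ≠ y)
    (h : T.dist s x = T.dist s y) :
    ∃ m b c, Betw T s m x ∧ Betw T s m y ∧ Toward T m x b ∧ Toward T m y c ∧ b ≠ c ∧
      (m = s ∨ IsMajor T m) := by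
  obtain ⟨m, b, c, h1, h2, h3, h4, h5⟩ := exists_branching hT hxy h
  refine ⟨m, b, c, h1, h2, h3, h4, h5, ?_⟩
  by_cases hms : m = s
  · exact Or.inl hms
  · obtain ⟨a, ha⟩ := exists_toward hT.1 hms
    have key : ∀ {z d}, Betw T s m z → Toward T m z d → a ≠ d := by
      rintro z d hz hd rfl
      have e1 := ha.2
      have e2 := hd.2
      have e3 := hT.1.dist_triangle (u := s) (v := a) (w := z)
      rw [T.dist_comm (u := m), T.dist_comm (u := a)] at e1
      unfold Betw at hz
      omega
    exact Or.inr (isMajor_of_adj ha.1 h3.1 h4.1 (key h1 h3) (key h2 h4) h5)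

/-! ### Legs -/

/-- The leg that joins `w` to its terminal vertex `l`, without `w` itself. -/
def leg (T : SimpleGraph V) (w l : V) : Set V := {x | x ≠ w ∧ Betw T w x l}

lemma IsTerminalVertexOf.ne {l w : V} (h : IsTerminalVertexOf T l w) : w ≠ l := by
  rintro rfl
  exact h.1.not_isMajor h.2.1

lemma IsTerminalVertexOf.unique {l w w' : V} (h : IsTerminalVertexOf T l w)
    (h' : IsTerminalVertexOf T l w') : w = w' := by
  by_contra hne
  have h1 := h.2.2 w' h'.2.1 (Ne.symm hne)
  have h2 := h'.2.2 w h.2.1 hne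
  omega

lemma exists_isTerminalVertexOf (hT : T.IsTree) (hM : ∃ w, IsMajor T w) {l : V}
    (hl : IsEndVertex T l) : ∃ w, IsTerminalVertexOf T l w := by
  classical
  obtain ⟨w, hw, hmin⟩ := Finset.exists_min_image (Finset.univ.filter fun w => IsMajor T w)
    (fun w => T.dist l w) (by simpa [Finset.filter_nonempty_iff] using hM)
  simp only [Finset.mem_filter, Finset.mem_univ, true_and] at hw hmin
  refine ⟨w, hl, hw, fun w' hw' hne => lt_of_le_of_ne (hmin w' hw') fun heq => ?_⟩
  obtain ⟨m, b, c, h1, -, h3, h4, h5, h6 | h6⟩ := exists_branching_isMajor hT hne.symm heq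
  · subst h6
    exact h5 (hl.adj_unique h3.1 h4.1)
  · have := hmin m h6
    have := h3.2
    unfold Betw at h1
    omega

lemma not_isMajor_of_mem_leg (hc : T.Connected) {w l x : V} (h : IsTerminalVertexOf T l w)
    (hx : x ∈ leg T w l) : ¬ IsMajor T x := by
  intro hm
  have h1 := h.2.2 x hm hx.1
  have h2 := hx.2
  have h3 := hc.pos_dist_of_ne hx.1.symm
  unfold Betw at h2
  rw [T.dist_comm, T.dist_comm (u := l)] at h1
  omega

/-- The branch at a major vertex that contains one of its terminal vertices is exactly the leg. -/
lemma mem_leg_of_toward (hT : T.IsTree) {w l x n : V} (h : IsTerminalVertexOf T l w)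
    (hl : Toward T w l n) (hx : Toward T w x n) : x ∈ leg T w l := by
  refine ⟨hx.ne.symm, ?_⟩
  induction hk : T.dist w x generalizing x with
  | zero => exact absurd (hT.1.dist_eq_zero_iff.1 hk) hx.ne
  | succ k ih =>
    obtain ⟨x', hx'⟩ := exists_toward hT.1 hx.ne.symm
    have hd : T.dist w x' = k := by
      have := hx'.2
      rw [T.dist_comm, hk, T.dist_comm (u := x')] at this
      omega
    by_cases hw : w = x'
    · subst hw
      rw [toward_unique hT (toward_of_adj hx'.1.symm) hx]
      exact hl.betw
    · have hn : Toward T w x' n := by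
        refine toward_of_not_betw hT hw hx fun hb => ?_
        have := hx'.2
        have := hT.1.pos_dist_of_ne hw
        unfold Betw at hb
        rw [dist_eq_one_of_adj hx'.1] at hb
        have := hT.1.pos_dist_of_ne hx.ne
        rw [T.dist_comm (u := x)] at hb
        omega
      have hb := ih hn hd
      obtain ⟨q, hq⟩ := exists_toward hT.1 (Ne.symm hw)
      have hqd := hq.2
      have hxd := hx'.2
      have hxq : x ≠ q := by
        rintro rfl
        omega
      by_cases hxl : x' = l
      · subst hxl
        exact absurd (h.1.adj_unique hx'.1.symm hq.1) hxq
      · obtain ⟨r, hr⟩ := exists_toward hT.1 hxl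
        have hrd := hr.2
        have hqr : q ≠ r := by
          rintro rfl
          have := hT.1.dist_triangle (u := w) (v := q) (w := l)
          unfold Betw at hb
          rw [T.dist_comm, T.dist_comm (u := q)] at hqd
          omega
        have hxr : x = r := by
          by_contra hxr
          exact not_isMajor_of_mem_leg hT.1 h ⟨Ne.symm hw, hb⟩
            (isMajor_of_adj hx'.1.symm hq.1 hr.1 hxq hxr hqr)
        subst hxr
        exact (hb.trans_right hT.1 hr.betw).1

/-- Unless `w` separates `x` from `l`, the vertex `x` lies on the leg of `l`. -/
lemma mem_leg_of_not_betw (hT : T.IsTree) {w l x : V} (h : IsTerminalVertexOf T l w)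
    (hx : x ≠ w) (hb : ¬ Betw T x w l) : x ∈ leg T w l := by
  obtain ⟨n, hn⟩ := exists_toward hT.1 hx.symm
  exact mem_leg_of_toward hT h (toward_of_not_betw hT h.ne hn hb) hn

lemma dist_lt_of_mem_leg (hT : T.IsTree) {w l x w' : V} (h : IsTerminalVertexOf T l w)
    (hx : x ∈ leg T w l) (hw' : IsMajor T w') (hne : w' ≠ w) : T.dist x w < T.dist x w' := by
  obtain ⟨n, hn⟩ := exists_toward hT.1 h.ne
  have hb : Betw T x w w' := by
    by_contra hb
    have := toward_of_not_betw hT hne.symm (toward_of_betw hT hx.1 hx.2 hn) hb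
    exact not_isMajor_of_mem_leg hT.1 h (mem_leg_of_toward hT h hn this) hw'
  have := hT.1.pos_dist_of_ne hne.symm
  unfold Betw at hb
  omega

lemma isNearestMajor_of_mem_leg (hT : T.IsTree) {w l x : V} (h : IsTerminalVertexOf T l w)
    (hx : x ∈ leg T w l) : IsNearestMajor T x w := by
  refine ⟨h.2.1, fun w' hw' => ?_⟩
  by_cases hne : w' = w
  · rw [hne]
  · exact (dist_lt_of_mem_leg hT h hx hw' hne).le

lemma mem_leg_self {w l : V} (h : IsTerminalVertexOf T l w) : l ∈ leg T w l :=
  ⟨h.ne.symm, betw_right _ _⟩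

/-- Distinct terminal vertices have disjoint legs. -/
lemma eq_of_mem_leg (hT : T.IsTree) {w l w' l' x : V} (h : IsTerminalVertexOf T l w)
    (h' : IsTerminalVertexOf T l' w') (hx : x ∈ leg T w l) (hx' : x ∈ leg T w' l') :
    l = l' := by
  have hw : w = w' := by
    by_contra hne
    have h1 := dist_lt_of_mem_leg hT h hx h'.2.1 (Ne.symm hne)
    have h2 := dist_lt_of_mem_leg hT h' hx' h.2.1 hne
    omega
  subst hw
  obtain ⟨n, hn⟩ := exists_toward hT.1 h.ne
  obtain ⟨n', hn'⟩ := exists_toward hT.1 h'.ne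
  have := toward_unique hT (toward_of_betw hT hx.1 hx.2 hn) (toward_of_betw hT hx'.1 hx'.2 hn')
  subst this
  have h1 := (mem_leg_of_toward hT h hn hn').2
  have h2 := (mem_leg_of_toward hT h' hn' hn).2
  unfold Betw at h1 h2
  have := T.dist_comm (u := l) (v := l')
  exact hT.1.dist_eq_zero_iff.1 (by omega)

/-! ### Interior vertices of degree two -/

lemma isInteriorDegreeTwo_iff (hT : T.IsTree) {v : V} : IsInteriorDegreeTwo T v ↔
    T.degree v = 2 ∧ ∀ l w, IsTerminalVertexOf T l w → ∃ x, Betw T v x l ∧ IsMajor T x := by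
  refine and_congr_right fun _ => ⟨fun h l w hl => ?_, fun h l ⟨w, hl⟩ p hp _ => ?_⟩
  · obtain ⟨p, hp⟩ := hT.1.exists_walk_length_eq_dist v l
    have hpp := p.isPath_of_length_eq_dist hp
    obtain ⟨x, hx, hm⟩ := h l ⟨w, hl⟩ p hpp hp
    exact ⟨x, (exists_isPath_mem_support_iff hT).1 ⟨p, hpp, hx⟩, hm⟩
  · obtain ⟨x, hx, hm⟩ := h l w hl
    obtain ⟨q, hq, hxq⟩ := (exists_isPath_mem_support_iff hT).2 hx
    rw [(hT.existsUnique_path v l).unique hp hq]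
    exact ⟨x, hxq, hm⟩

lemma not_isInteriorDegreeTwo_of_mem_leg (hT : T.IsTree) {w l x : V}
    (h : IsTerminalVertexOf T l w) (hx : x ∈ leg T w l) : ¬ IsInteriorDegreeTwo T x := by
  intro hi
  obtain ⟨m, hm, hmaj⟩ := ((isInteriorDegreeTwo_iff hT).1 hi).2 l w h
  obtain ⟨h1, h2⟩ := hx.2.trans_right hT.1 hm
  refine not_isMajor_of_mem_leg hT.1 h ⟨?_, h1⟩ hmaj
  rintro rfl
  have := hT.1.pos_dist_of_ne hx.1
  unfold Betw at h2
  simp only [SimpleGraph.dist_self] at h2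
  omega

/-- The tree is made up of the major vertices, the interior vertices of degree two, and the
legs. -/
lemma isMajor_or_interior_or_mem_leg [Nontrivial V] (hT : T.IsTree) (hM : ∃ w, IsMajor T w)
    (x : V) : IsMajor T x ∨ IsInteriorDegreeTwo T x ∨
      ∃ l w, IsTerminalVertexOf T l w ∧ x ∈ leg T w l := by
  by_cases h3 : IsMajor T x
  · exact Or.inl h3
  refine Or.inr ?_
  by_cases h1 : IsEndVertex T x
  · obtain ⟨w, hw⟩ := exists_isTerminalVertexOf hT hM h1
    exact Or.inr ⟨x, w, hw, mem_leg_self hw⟩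
  · by_cases hi : IsInteriorDegreeTwo T x
    · exact Or.inl hi
    have h2 : T.degree x = 2 := by
      have := one_le_degree hT.1 x
      unfold IsMajor at h3
      unfold IsEndVertex at h1
      omega
    simp only [isInteriorDegreeTwo_iff hT, h2, true_and, not_forall, not_exists, not_and] at hi
    obtain ⟨l, w, hl, hi⟩ := hi
    refine Or.inr ⟨l, w, hl, mem_leg_of_not_betw hT hl ?_ fun hb => hi w hb hl.2.1⟩
    rintro rfl
    exact h3 hl.2.1

/-- Every branch at an interior vertex of degree two contains a major vertex. -/
lemma IsInteriorDegreeTwo.exists_isMajor_toward [Nontrivial V] (hT : T.IsTree)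
    (hM : ∃ w, IsMajor T w) {v b : V} (hv : IsInteriorDegreeTwo T v) (hb : T.Adj v b) :
    ∃ m, IsMajor T m ∧ Toward T v m b := by
  classical
  obtain ⟨h2, hv⟩ := (isInteriorDegreeTwo_iff hT).1 hv
  -- a vertex of the branch farthest from `v` is an end vertex
  obtain ⟨l, hl, hmax⟩ := Finset.exists_max_image (Finset.univ.filter fun x => Toward T v x b)
    (fun x => T.dist v x) ⟨b, by simpa using toward_of_adj hb⟩
  simp only [Finset.mem_filter, Finset.mem_univ, true_and] at hl hmax
  have hend : IsEndVertex T l := by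
    by_contra hne
    obtain ⟨q, hq⟩ := exists_toward hT.1 hl.ne.symm
    obtain ⟨c, hc, hcq⟩ := exists_adj_ne_of_two_le_degree (T := T) (v := l) (by
      have := one_le_degree hT.1 l
      unfold IsEndVertex at hne
      omega) q
    have hd := dist_of_not_toward hT hc (fun h => hcq (toward_unique hT h hq))
    have hcv : v ≠ c := by
      rintro rfl
      simp at hd
    have hbc : Betw T v l c := by
      unfold Betw
      rw [dist_eq_one_of_adj hc, T.dist_comm, T.dist_comm (u := v) (v := c), hd]
    have := hmax c ((toward_iff_betw hb).2 (hbc.trans_left hT.1 hl.betw).1)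
    rw [T.dist_comm (u := v) (v := c), hd, T.dist_comm (u := l)] at this
    omega
  obtain ⟨w, hw⟩ := exists_isTerminalVertexOf hT hM hend
  obtain ⟨m, hm, hmaj⟩ := hv l w hw
  have hvm : v ≠ m := by
    rintro rfl
    unfold IsMajor at hmaj
    omega
  obtain ⟨a, ha⟩ := exists_toward hT.1 hvm
  have hab := toward_unique hT ((toward_iff_betw ha.1).2 (hm.trans_left hT.1 ha.betw).1) hl
  exact ⟨m, hmaj, hab ▸ ha⟩

end Legs

section Resolving

variable {V : Type*} {T : SimpleGraph V}

/-! ### Connected resolving sets of a tree with a major vertex -/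

/-- Two branches at `w` that both miss a resolving set coincide, because their first vertices are
equally far from everything outside them. -/
lemma IsResolvingSet.eq_of_not_toward (hT : T.IsTree) {S : Set V} (hS : IsResolvingSet T S)
    {w b c : V} (hb : T.Adj w b) (hc : T.Adj w c) (hbS : ∀ z ∈ S, ¬ Toward T w z b)
    (hcS : ∀ z ∈ S, ¬ Toward T w z c) : b = c := by
  by_contra hne
  obtain ⟨z, hz, hres⟩ := hS b c hne
  exact hres ((dist_of_not_toward hT hb (hbS z hz)).trans
    (dist_of_not_toward hT hc (hcS z hz)).symm)

/-- A geodesically convex set lies in a single branch at each vertex outside it. -/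
lemma GeodConvex.exists_forall_toward (hT : T.IsTree) {S : Set V} (hS : GeodConvex T S)
    (hne : S.Nonempty) {w : V} (hw : w ∉ S) : ∃ a, ∀ z ∈ S, Toward T w z a := by
  obtain ⟨s, hs⟩ := hne
  have hsw : ∀ z ∈ S, w ≠ z := by
    rintro z hz rfl
    exact hw hz
  obtain ⟨a, ha⟩ := exists_toward hT.1 (hsw s hs)
  exact ⟨a, fun z hz => toward_of_not_betw hT (hsw z hz) ha fun hb => hw (hS s hs z hz w hb)⟩

lemma IsConnectedResolvingSet.eq_of_adj_of_notMem (hT : T.IsTree) {S : Set V}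
    (hS : IsConnectedResolvingSet T S) {w b c : V} (hw : w ∈ S) (hb : T.Adj w b)
    (hc : T.Adj w c) (hbS : b ∉ S) (hcS : c ∉ S) : b = c := by
  have hconv := ((induce_connected_iff hT).1 hS.2).2
  exact hS.1.eq_of_not_toward hT hb hc (fun z hz h => hbS (hconv w hw z hz b h.betw))
    (fun z hz h => hcS (hconv w hw z hz c h.betw))

variable [Fintype V] [DecidableRel T.Adj]

lemma IsConnectedResolvingSet.mem_of_isMajor (hT : T.IsTree) {S : Set V}
    (hS : IsConnectedResolvingSet T S) {w : V} (hw : IsMajor T w) : w ∈ S := by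
  by_contra hwS
  obtain ⟨hne, hconv⟩ := (induce_connected_iff hT).1 hS.2
  obtain ⟨a, ha⟩ := hconv.exists_forall_toward hT hne hwS
  obtain ⟨b, c, hb, hc, hba, hca, hbc⟩ := exists_adj_ne_of_isMajor hw a
  exact hbc (hS.1.eq_of_not_toward hT hb hc (fun z hz h => hba (toward_unique hT h (ha z hz)))
    (fun z hz h => hca (toward_unique hT h (ha z hz))))

lemma IsConnectedResolvingSet.mem_of_isInteriorDegreeTwo [Nontrivial V] (hT : T.IsTree)
    (hM : ∃ w, IsMajor T w) {S : Set V} (hS : IsConnectedResolvingSet T S) {v : V}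
    (hv : IsInteriorDegreeTwo T v) : v ∈ S := by
  by_contra hvS
  obtain ⟨hne, hconv⟩ := (induce_connected_iff hT).1 hS.2
  obtain ⟨a, ha⟩ := hconv.exists_forall_toward hT hne hvS
  obtain ⟨b, hb, hba⟩ := exists_adj_ne_of_two_le_degree hv.1.ge a
  obtain ⟨m, hm, hmb⟩ := hv.exists_isMajor_toward hT hM hb
  exact hba (toward_unique hT hmb (ha m (hS.mem_of_isMajor hT hm)))

/-- Two vertices that are equally far from a major vertex diverge at a major vertex `m`; one of
the two neighbours of `m` at which they diverge lies in the set and resolves them. -/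
lemma isResolvingSet_of_isMajor_subset (hT : T.IsTree) (hM : ∃ w, IsMajor T w) {S : Set V}
    (hmaj : ∀ w, IsMajor T w → w ∈ S)
    (hnbr : ∀ w b c, IsMajor T w → T.Adj w b → T.Adj w c → b ∉ S → c ∉ S → b = c) :
    IsResolvingSet T S := by
  intro x y hxy
  by_contra hcon
  simp only [Resolves, not_exists, not_and, not_not] at hcon
  obtain ⟨s, hs⟩ := hM
  have hsd : T.dist s x = T.dist s y := by
    rw [T.dist_comm, T.dist_comm (u := s)]
    exact hcon s (hmaj s hs)
  obtain ⟨m, b, c, -, -, hb, hc, hbc, hm⟩ := exists_branching_isMajor hT hxy hsd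
  have hm : IsMajor T m := by
    rcases hm with rfl | hm
    · exact hs
    · exact hm
  have e1 := hcon m (hmaj m hm)
  have e2 := dist_of_not_toward hT hb.1 fun h => hbc (toward_unique hT h hc)
  have e3 := dist_of_not_toward hT hc.1 fun h => hbc (toward_unique hT hb h)
  have e4 := hb.2
  have e5 := hc.2
  rw [T.dist_comm, T.dist_comm (u := y)] at e1
  have hor : b ∈ S ∨ c ∈ S := by
    by_contra hno
    rw [not_or] at hno
    exact hbc (hnbr m b c hm hb.1 hc.1 hno.1 hno.2)
  rcases hor with h | h
  · have := hcon b h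
    rw [T.dist_comm, T.dist_comm (u := y)] at this
    omega
  · have := hcon c h
    rw [T.dist_comm, T.dist_comm (u := y)] at this
    omega

/-! ### Trees with pruned legs -/

/-- What remains of the tree when the leg of every end vertex `l` is cut off after its first `h l`
vertices, counted from the major vertex. -/
def prunedSet (T : SimpleGraph V) [DecidableRel T.Adj] (h : V → ℕ) : Set V :=
  {x | ∀ l w, IsTerminalVertexOf T l w → x ∈ leg T w l → T.dist w x ≤ h l}

lemma mem_prunedSet_of_isMajor (hT : T.IsTree) {h : V → ℕ} {w : V} (hw : IsMajor T w) :
    w ∈ prunedSet T h :=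
  fun _ _ hl hx => absurd hw (not_isMajor_of_mem_leg hT.1 hl hx)

lemma mem_prunedSet_of_isInteriorDegreeTwo (hT : T.IsTree) {h : V → ℕ} {v : V}
    (hv : IsInteriorDegreeTwo T v) : v ∈ prunedSet T h :=
  fun _ _ hl hx => absurd hv (not_isInteriorDegreeTwo_of_mem_leg hT hl hx)

lemma mem_prunedSet_of_mem_leg (hT : T.IsTree) {h : V → ℕ} {l w x : V}
    (hl : IsTerminalVertexOf T l w) (hx : x ∈ leg T w l) :
    x ∈ prunedSet T h ↔ T.dist w x ≤ h l := by
  refine ⟨fun hS => hS l w hl hx, fun hd l' w' hl' hx' => ?_⟩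
  have := eq_of_mem_leg hT hl hl' hx hx'
  subst this
  rwa [← hl.unique hl']

lemma geodConvex_prunedSet (hT : T.IsTree) (h : V → ℕ) : GeodConvex T (prunedSet T h) := by
  intro x hx y hy z hz l w hl hzl
  by_contra hlt
  have hzS : z ∉ prunedSet T h := fun hS => hlt (hS l w hl hzl)
  have hzx : z ≠ x := by
    rintro rfl
    exact hzS hx
  have hzy : z ≠ y := by
    rintro rfl
    exact hzS hy
  obtain ⟨n, hn⟩ := exists_toward hT.1 hl.ne
  obtain ⟨q, hq⟩ := exists_toward hT.1 hzl.1
  -- a vertex outside the branch of `z` that contains `w` lies further along the leg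
  have key : ∀ u ∈ prunedSet T h, z ≠ u → Toward T z u q := by
    intro u hu hzu
    obtain ⟨r, hr⟩ := exists_toward hT.1 hzu
    by_cases hrq : r = q
    · exact hrq ▸ hr
    · have hb := betw_of_toward_ne hT hq hr (Ne.symm hrq)
      have hwz := toward_of_betw hT hzl.1 hzl.2 hn
      have hwu := (toward_iff_betw hwz.1).2 (hb.trans_left hT.1 hwz.betw).1
      have := hu l w hl (mem_leg_of_toward hT hl hn hwu)
      unfold Betw at hb
      omega
  have h1 := (key x hx hzx).2
  have h2 := (key y hy hzy).2
  have h3 := hT.1.dist_triangle (u := x) (v := q) (w := y)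
  unfold Betw at hz
  rw [T.dist_comm (u := x) (v := q)] at h3
  rw [T.dist_comm (u := x) (v := z)] at hz
  omega

lemma isConnectedResolvingSet_prunedSet (hT : T.IsTree) (hM : ∃ w, IsMajor T w) {h : V → ℕ}
    (hz : ∀ w l l', IsTerminalVertexOf T l w → IsTerminalVertexOf T l' w →
      h l = 0 → h l' = 0 → l = l') :
    IsConnectedResolvingSet T (prunedSet T h) := by
  refine ⟨isResolvingSet_of_isMajor_subset hT hM (fun w => mem_prunedSet_of_isMajor hT) ?_,
    (induce_connected_iff hT).2 ⟨?_, geodConvex_prunedSet hT h⟩⟩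
  · intro w b c hw hb hc hbS hcS
    -- a missing neighbour of `w` is the first vertex of a leg that is cut off entirely
    have key : ∀ b, T.Adj w b → b ∉ prunedSet T h →
        ∃ l, IsTerminalVertexOf T l w ∧ b ∈ leg T w l ∧ h l = 0 := by
      intro b hb hbS
      simp only [prunedSet, Set.mem_ofPred_eq, not_forall, not_le] at hbS
      obtain ⟨l, w', hl, hbl, hlt⟩ := hbS
      have h1 := dist_eq_one_of_adj hb
      have hww : w = w' := by
        by_contra hne
        have h2 := dist_lt_of_mem_leg hT hl hbl hw hne
        rw [T.dist_comm (v := w), h1] at h2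
        exact hbl.1 (hT.1.dist_eq_zero_iff.1 (by omega))
      subst hww
      exact ⟨l, hl, hbl, by omega⟩
    obtain ⟨l, hl, hbl, hl0⟩ := key b hb hbS
    obtain ⟨l', hl', hcl, hl0'⟩ := key c hc hcS
    have := hz w l l' hl hl' hl0 hl0'
    subst this
    exact betw_unique hT hbl.2 hcl.2 ((dist_eq_one_of_adj hb).trans (dist_eq_one_of_adj hc).symm)
  · obtain ⟨w, hw⟩ := hM
    exact ⟨w, mem_prunedSet_of_isMajor hT hw⟩

end Resolving

/-! ### Sums over the fibres of a map -/

section Sums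

variable {α β : Type*} [DecidableEq β]

/-- If `g` has at most one zero in each fibre of `f`, then it sums up to at least the number of
points minus the number of fibres. -/
lemma card_le_sum_add_card_image (A : Finset α) (f : α → β) (g : α → ℕ)
    (hg : ∀ x ∈ A, ∀ y ∈ A, g x = 0 → g y = 0 → f x = f y → x = y) :
    A.card ≤ ∑ x ∈ A, g x + (A.image f).card := by
  rw [← Finset.card_filter_add_card_filter_not (s := A) (fun x => g x = 0), add_comm]
  refine add_le_add ?_ ?_
  · calc (A.filter fun x => ¬ g x = 0).card = ∑ x ∈ A.filter fun x => ¬ g x = 0, 1 := by simp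
      _ ≤ ∑ x ∈ A.filter fun x => ¬ g x = 0, g x := Finset.sum_le_sum fun x hx => by
          have := (Finset.mem_filter.1 hx).2
          omega
      _ ≤ ∑ x ∈ A, g x :=
          Finset.sum_le_sum_of_subset (Finset.filter_subset _ _)
  · refine Finset.card_le_card_of_injOn f (fun x hx => ?_) fun x hx y hy hxy => ?_
    · exact Finset.mem_coe.2 (Finset.mem_image_of_mem f (Finset.mem_filter.1 hx).1)
    · have hx := Finset.mem_filter.1 hx
      have hy := Finset.mem_filter.1 hy
      exact hg x hx.1 y hy.1 hx.2 hy.2 hxy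

variable [DecidableEq α]

/-- The value `g a` counts in full at the cost of the point `a`; a fibre that consists of `a` alone
then no longer allows a zero. -/
lemma card_add_le_sum_add_card_image (A : Finset α) (f : α → β) (g : α → ℕ)
    (hg : ∀ x ∈ A, ∀ y ∈ A, g x = 0 → g y = 0 → f x = f y → x = y) {a : α} (ha : a ∈ A) :
    A.card + g a ≤ ∑ x ∈ A, g x + (A.image f).card + 1 ∧
      ((∀ x ∈ A, f x = f a → x = a) → A.card + g a ≤ ∑ x ∈ A, g x + (A.image f).card) := by
  have h1 := card_le_sum_add_card_image (A.erase a) f g fun x hx y hy =>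
    hg x (Finset.mem_of_mem_erase hx) y (Finset.mem_of_mem_erase hy)
  have h2 := Finset.add_sum_erase A g ha
  have h3 := Finset.card_erase_add_one ha
  refine ⟨?_, fun huniq => ?_⟩
  · have h4 := Finset.card_le_card (Finset.image_subset_image (f := f) (Finset.erase_subset a A))
    omega
  · have h4 : ((A.erase a).image f).card < (A.image f).card := by
      refine Finset.card_lt_card ((Finset.ssubset_iff_of_subset
        (Finset.image_subset_image (Finset.erase_subset a A))).2
          ⟨f a, Finset.mem_image_of_mem f ha, fun hmem => ?_⟩)
      obtain ⟨x, hx, hxa⟩ := Finset.mem_image.1 hmem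
      exact (Finset.mem_erase.1 hx).1 (huniq x (Finset.mem_erase.1 hx).2 hxa)
    omega

/-- There is a transversal of the fibres of `f` that avoids `a` if it can; `h` is the indicator
function of its complement. -/
lemma exists_sum_add_card_image_eq (A : Finset α) (f : α → β) (a : α) :
    ∃ h : α → ℕ, (∀ x, h x ≤ 1) ∧
      (∀ x ∈ A, ∀ y ∈ A, h x = 0 → h y = 0 → f x = f y → x = y) ∧
      ∑ x ∈ A, h x + (A.image f).card = A.card ∧
      ((∃ x ∈ A, x ≠ a ∧ f x = f a) → h a = 1) ∧
      (a ∈ A → (∀ x ∈ A, f x = f a → x = a) → h a = 0) := by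
  have hsec : ∀ b, ∃ x, b ∈ A.image f →
      x ∈ A ∧ f x = b ∧ ((∃ y ∈ A, y ≠ a ∧ f y = b) → x ≠ a) := by
    intro b
    by_cases hb : ∃ y ∈ A, y ≠ a ∧ f y = b
    · obtain ⟨y, hy, hya, hyb⟩ := hb
      exact ⟨y, fun _ => ⟨hy, hyb, fun _ => hya⟩⟩
    · by_cases hb' : b ∈ A.image f
      · obtain ⟨y, hy, hyb⟩ := Finset.mem_image.1 hb'
        exact ⟨y, fun _ => ⟨hy, hyb, fun h => absurd h hb⟩⟩
      · exact ⟨a, fun h => absurd h hb'⟩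
  choose s hs using hsec
  have hs' : ∀ x ∈ A, s (f x) ∈ A ∧ f (s (f x)) = f x ∧
      ((∃ y ∈ A, y ≠ a ∧ f y = f x) → s (f x) ≠ a) :=
    fun x hx => hs (f x) (Finset.mem_image_of_mem f hx)
  refine ⟨fun x => if s (f x) = x then 0 else 1, fun x => ?_, fun x _ y _ hx hy hxy => ?_, ?_,
    ?_, ?_⟩
  · dsimp only
    split_ifs <;> omega
  · simp only [ite_eq_left_iff, one_ne_zero, imp_false, not_not] at hx hy
    rw [← hx, ← hy, hxy]
  · have hcard : (A.image f).card = (A.filter fun x => s (f x) = x).card := by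
      symm
      refine Finset.card_nbij f (fun x hx => ?_) (fun x hx y hy hxy => ?_) fun b hb => ?_
      · exact Finset.mem_coe.2 (Finset.mem_image_of_mem f (Finset.mem_filter.1 hx).1)
      · have hx := (Finset.mem_filter.1 hx).2
        have hy := (Finset.mem_filter.1 hy).2
        rw [← hx, ← hy, hxy]
      · obtain ⟨h1, h2, -⟩ := hs b hb
        exact ⟨s b, Finset.mem_coe.2 (Finset.mem_filter.2 ⟨h1, by rw [h2]⟩), h2⟩
    rw [hcard, ← Finset.card_filter_add_card_filter_not (s := A) (fun x => s (f x) = x), add_comm]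
    simp [Finset.sum_ite]
  · rintro ⟨x, hx, hxa, hfx⟩
    have := (hs' x hx).2.2 ⟨x, hx, hxa, rfl⟩
    rw [hfx] at this
    simp [this]
  · intro ha huniq
    have := huniq _ (hs' a ha).1 (hs' a ha).2.1
    simp [this]

end Sums

section Counting

variable {V : Type*} {T : SimpleGraph V}

/-! ### Counting vertices leg by leg -/

lemma ncard_leg_dist_le (hT : T.IsTree) {w l : V} {k : ℕ} (hk : k ≤ T.dist w l) :
    {x | x ∈ leg T w l ∧ T.dist w x ≤ k}.ncard = k := by
  have himg : T.dist w '' {x | x ∈ leg T w l ∧ T.dist w x ≤ k} = Set.Icc 1 k := by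
    ext j
    constructor
    · rintro ⟨x, ⟨hx, hxk⟩, rfl⟩
      exact ⟨hT.1.pos_dist_of_ne hx.1.symm, hxk⟩
    · rintro ⟨h1, h2⟩
      obtain ⟨x, hx, hxj⟩ := exists_betw_dist_eq hT.1 w l (h2.trans hk)
      refine ⟨x, ⟨⟨?_, hx⟩, hxj.le.trans h2⟩, hxj⟩
      rintro rfl
      simp only [SimpleGraph.dist_self] at hxj
      omega
  have hinj : Set.InjOn (T.dist w) {x | x ∈ leg T w l ∧ T.dist w x ≤ k} :=
    fun x hx y hy hxy => betw_unique hT hx.1.2 hy.1.2 hxy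
  rw [← hinj.ncard_image, himg, ← Finset.coe_Icc,
    Set.ncard_coe_finset, Nat.card_Icc]
  omega

variable [Fintype V] [DecidableRel T.Adj]

/-- The vertices outside the legs: the major vertices and the interior vertices of degree two. -/
def trunk (T : SimpleGraph V) [DecidableRel T.Adj] : Set V :=
  {x | IsMajor T x ∨ IsInteriorDegreeTwo T x}

open Classical in
/-- The end vertices, as a finite set. -/
noncomputable def endVertices (T : SimpleGraph V) [DecidableRel T.Adj] : Finset V :=
  Finset.univ.filter fun l => IsEndVertex T l

lemma mem_endVertices {l : V} : l ∈ endVertices T ↔ IsEndVertex T l := by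
  simp [endVertices]

lemma card_endVertices : (endVertices T).card = numEndVertices T := by
  unfold numEndVertices
  rw [← Set.ncard_coe_finset]
  congr 1
  ext l
  simp [mem_endVertices]

open Classical in
/-- The major vertex of which `l` is a terminal vertex; `l` itself if there is none. -/
noncomputable def majorOf (T : SimpleGraph V) [DecidableRel T.Adj] (l : V) : V :=
  if h : ∃ w, IsTerminalVertexOf T l w then h.choose else l

lemma IsTerminalVertexOf.majorOf_eq {l w : V} (h : IsTerminalVertexOf T l w) :
    majorOf T l = w := by
  have hex : ∃ w, IsTerminalVertexOf T l w := ⟨w, h⟩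
  unfold majorOf
  rw [dif_pos hex]
  exact hex.choose_spec.unique h

lemma isTerminalVertexOf_majorOf (hT : T.IsTree) (hM : ∃ w, IsMajor T w) {l : V}
    (hl : l ∈ endVertices T) : IsTerminalVertexOf T l (majorOf T l) := by
  obtain ⟨w, hw⟩ := exists_isTerminalVertexOf hT hM (mem_endVertices.1 hl)
  rwa [hw.majorOf_eq]

/-- A set that contains the trunk splits into the trunk and its parts on the legs. -/
lemma ncard_eq_trunk_add_sum [Nontrivial V] (hT : T.IsTree) (hM : ∃ w, IsMajor T w) {S : Set V}
    (hS : trunk T ⊆ S) : S.ncard =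
      (trunk T).ncard + ∑ l ∈ endVertices T, (S ∩ leg T (majorOf T l) l).ncard := by
  classical
  have hSeq : S = trunk T ∪
      ((endVertices T).biUnion fun l => (S ∩ leg T (majorOf T l) l).toFinset : Finset V) := by
    ext x
    simp only [Set.mem_union, Finset.mem_coe, Finset.mem_biUnion, Set.mem_toFinset]
    constructor
    · intro hx
      rcases isMajor_or_interior_or_mem_leg hT hM x with h | h | ⟨l, w, hl, hxl⟩
      · exact Or.inl (Or.inl h)
      · exact Or.inl (Or.inr h)
      · exact Or.inr ⟨l, mem_endVertices.2 hl.1, hx, by rwa [hl.majorOf_eq]⟩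
    · rintro (hx | ⟨l, -, hx⟩)
      · exact hS hx
      · exact hx.1
  have hdisj : Disjoint (trunk T) ((endVertices T).biUnion
      fun l => (S ∩ leg T (majorOf T l) l).toFinset : Finset V) := by
    rw [Set.disjoint_left]
    intro x hx hx'
    simp only [Finset.mem_coe, Finset.mem_biUnion, Set.mem_toFinset] at hx'
    obtain ⟨l, hl, -, hxl⟩ := hx'
    have hl' := isTerminalVertexOf_majorOf hT hM hl
    rcases hx with hx | hx
    · exact not_isMajor_of_mem_leg hT.1 hl' hxl hx
    · exact not_isInteriorDegreeTwo_of_mem_leg hT hl' hxl hx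
  conv_lhs => rw [hSeq]
  rw [Set.ncard_union_eq hdisj (Set.toFinite _) (Set.toFinite _), Set.ncard_coe_finset,
    Finset.card_biUnion]
  · congr 1
    exact Finset.sum_congr rfl fun l _ => (Set.ncard_eq_toFinset_card' _).symm
  · intro l hl l' hl' hne
    rw [Function.onFun, Finset.disjoint_left]
    intro x hx hx'
    rw [Set.mem_toFinset] at hx hx'
    exact hne (eq_of_mem_leg hT (isTerminalVertexOf_majorOf hT hM hl)
      (isTerminalVertexOf_majorOf hT hM hl') hx.2 hx'.2)

lemma terminalDegree_pos_iff {w : V} :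
    0 < terminalDegree T w ↔ ∃ l, IsTerminalVertexOf T l w := by
  unfold terminalDegree
  rw [Set.ncard_pos (Set.toFinite _)]
  rfl

open Classical in
/-- The exterior major vertices are the values of `majorOf` on the end vertices; the rest of the
trunk is the interior set. -/
lemma ncard_trunk (hT : T.IsTree) (hM : ∃ w, IsMajor T w) : (trunk T).ncard =
    (interiorSet T).ncard + ((endVertices T).image (majorOf T)).card := by
  have hmem : ∀ x, x ∈ (endVertices T).image (majorOf T) ↔
      IsMajor T x ∧ 0 < terminalDegree T x := by
    intro x
    rw [terminalDegree_pos_iff, Finset.mem_image]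
    constructor
    · rintro ⟨l, hl, rfl⟩
      have := isTerminalVertexOf_majorOf hT hM hl
      exact ⟨this.2.1, l, this⟩
    · rintro ⟨-, l, hl⟩
      exact ⟨l, mem_endVertices.2 hl.1, hl.majorOf_eq⟩
  have hunion : trunk T = interiorSet T ∪ ((endVertices T).image (majorOf T) : Finset V) := by
    ext x
    rw [Set.mem_union, Finset.mem_coe, hmem]
    constructor
    · rintro (h | h)
      · rcases Nat.eq_zero_or_pos (terminalDegree T x) with h0 | h0
        · exact Or.inl (Or.inr ⟨h, h0⟩)
        · exact Or.inr ⟨h, h0⟩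
      · exact Or.inl (Or.inl h)
    · rintro ((h | h) | h)
      · exact Or.inr h
      · exact Or.inl h.1
      · exact Or.inl h.1
  rw [hunion, Set.ncard_union_eq ?_ (Set.toFinite _) (Set.toFinite _), Set.ncard_coe_finset]
  rw [Set.disjoint_left]
  intro x hx hx'
  rw [Finset.mem_coe, hmem] at hx'
  rcases hx with h | h
  · have h1 := h.1
    have h2 := hx'.1
    unfold IsMajor at h2
    omega
  · omega

lemma IsConnectedResolvingSet.trunk_subset [Nontrivial V] (hT : T.IsTree)
    (hM : ∃ w, IsMajor T w) {S : Set V} (hS : IsConnectedResolvingSet T S) : trunk T ⊆ S := by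
  rintro x (hx | hx)
  · exact hS.mem_of_isMajor hT hx
  · exact hS.mem_of_isInteriorDegreeTwo hT hM hx

/-- A connected resolving set misses at most one of the legs at each major vertex. -/
lemma IsConnectedResolvingSet.eq_of_leg_eq_zero (hT : T.IsTree) {S : Set V}
    (hS : IsConnectedResolvingSet T S) {w l l' : V} (hl : IsTerminalVertexOf T l w)
    (hl' : IsTerminalVertexOf T l' w) (h0 : (S ∩ leg T w l).ncard = 0)
    (h0' : (S ∩ leg T w l').ncard = 0) : l = l' := by
  rw [Set.ncard_eq_zero (Set.toFinite _)] at h0 h0'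
  obtain ⟨b, hb⟩ := exists_toward hT.1 hl.ne
  obtain ⟨c, hc⟩ := exists_toward hT.1 hl'.ne
  have hbl : b ∈ leg T w l := ⟨hb.1.ne', hb.betw⟩
  have hcl : c ∈ leg T w l' := ⟨hc.1.ne', hc.betw⟩
  have hbc := hS.eq_of_adj_of_notMem hT (hS.mem_of_isMajor hT hl.2.1) hb.1 hc.1
    (fun h => (h0 ▸ (⟨h, hbl⟩ : b ∈ S ∩ leg T w l) : b ∈ (∅ : Set V)))
    (fun h => (h0' ▸ (⟨h, hcl⟩ : c ∈ S ∩ leg T w l') : c ∈ (∅ : Set V)))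
  subst hbc
  exact eq_of_mem_leg hT hl hl' hbl hcl

open Classical in
lemma IsConnectedResolvingSet.le_ncard [Nontrivial V] (hT : T.IsTree) (hM : ∃ w, IsMajor T w)
    {S : Set V} (hS : IsConnectedResolvingSet T S) :
    (interiorSet T).ncard + numEndVertices T ≤ S.ncard := by
  have h1 := ncard_eq_trunk_add_sum hT hM (hS.trunk_subset hT hM)
  have h2 := ncard_trunk hT hM
  have h3 := card_le_sum_add_card_image (endVertices T) (majorOf T)
    (fun l => (S ∩ leg T (majorOf T l) l).ncard) fun l hl l' hl' h0 h0' heq => by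
      have := isTerminalVertexOf_majorOf hT hM hl'
      rw [← heq] at this h0'
      exact hS.eq_of_leg_eq_zero hT (isTerminalVertexOf_majorOf hT hM hl) this h0 h0'
  rw [card_endVertices] at h3
  omega

open Classical in
/-- A vertex `v` of the set on the leg of `l` brings in the whole path from `w` to `v`. If the leg
of `l` is the only one at `w`, no other leg can be avoided in its place. -/
lemma IsConnectedResolvingSet.le_ncard_of_mem_leg [Nontrivial V] (hT : T.IsTree) {S : Set V}
    (hS : IsConnectedResolvingSet T S) {l w v : V} (hl : IsTerminalVertexOf T l w)
    (hv : v ∈ leg T w l) (hvS : v ∈ S) :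
    (interiorSet T).ncard + numEndVertices T + T.dist v w ≤ S.ncard + 1 ∧
      ((∀ l', IsTerminalVertexOf T l' w → l' = l) →
        (interiorSet T).ncard + numEndVertices T + T.dist v w ≤ S.ncard) := by
  have hM : ∃ w, IsMajor T w := ⟨w, hl.2.1⟩
  have h1 := ncard_eq_trunk_add_sum hT hM (hS.trunk_subset hT hM)
  have h2 := ncard_trunk hT hM
  have h3 := card_add_le_sum_add_card_image (endVertices T) (majorOf T)
    (fun l => (S ∩ leg T (majorOf T l) l).ncard) (fun l hl l' hl' h0 h0' heq => by
      have := isTerminalVertexOf_majorOf hT hM hl'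
      rw [← heq] at this h0'
      exact hS.eq_of_leg_eq_zero hT (isTerminalVertexOf_majorOf hT hM hl) this h0 h0')
    (mem_endVertices.2 hl.1)
  rw [card_endVertices] at h3
  -- the set contains the geodesic from `w` to `v`
  have h4 : T.dist v w ≤ (S ∩ leg T (majorOf T l) l).ncard := by
    rw [hl.majorOf_eq, T.dist_comm]
    refine (ncard_leg_dist_le hT (l := v) le_rfl).symm.le.trans
      (Set.ncard_le_ncard (fun x hx => ⟨?_, hx.1.1, ?_⟩) (Set.toFinite _))
    · exact ((induce_connected_iff hT).1 hS.2).2 w (hS.mem_of_isMajor hT hl.2.1) v hvS x hx.1.2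
    · exact (hv.2.trans_left hT.1 hx.1.2).1
  refine ⟨by omega, fun huniq => ?_⟩
  have := h3.2 fun x hx hxl => huniq x (by
    have := isTerminalVertexOf_majorOf hT hM hx
    rwa [hxl, hl.majorOf_eq] at this)
  omega

lemma ncard_prunedSet [Nontrivial V] (hT : T.IsTree) (hM : ∃ w, IsMajor T w) {h : V → ℕ}
    (hh : ∀ l ∈ endVertices T, h l ≤ T.dist (majorOf T l) l) :
    (prunedSet T h).ncard = (trunk T).ncard + ∑ l ∈ endVertices T, h l := by
  rw [ncard_eq_trunk_add_sum hT hM]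
  · congr 1
    refine Finset.sum_congr rfl fun l hl => ?_
    conv_rhs => rw [← ncard_leg_dist_le hT (hh l hl)]
    congr 1
    ext x
    have hl' := isTerminalVertexOf_majorOf hT hM hl
    exact ⟨fun hx => ⟨hx.2, (mem_prunedSet_of_mem_leg hT hl' hx.2).1 hx.1⟩,
      fun hx => ⟨(mem_prunedSet_of_mem_leg hT hl' hx.1).2 hx.2, hx.1⟩⟩
  · rintro x (hx | hx)
    · exact mem_prunedSet_of_isMajor hT hx
    · exact mem_prunedSet_of_isInteriorDegreeTwo hT hx

/-! ### Optimal connected resolving sets -/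

lemma exists_ncard_eq [Nontrivial V] (hT : T.IsTree) (hM : ∃ w, IsMajor T w) :
    ∃ S, IsConnectedResolvingSet T S ∧
      S.ncard = (interiorSet T).ncard + numEndVertices T := by
  classical
  obtain ⟨h, hle, hz, hsum, -⟩ :=
    exists_sum_add_card_image_eq (endVertices T) (majorOf T) (Classical.choice hT.1.nonempty)
  refine ⟨prunedSet T h, isConnectedResolvingSet_prunedSet hT hM fun w l l' hl hl' h0 h0' =>
    hz l (mem_endVertices.2 hl.1) l' (mem_endVertices.2 hl'.1) h0 h0'
      (hl.majorOf_eq.trans hl'.majorOf_eq.symm), ?_⟩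
  rw [ncard_prunedSet hT hM fun l hl => (hle l).trans
    (hT.1.pos_dist_of_ne (isTerminalVertexOf_majorOf hT hM hl).ne), ncard_trunk hT hM,
    ← card_endVertices]
  omega

/-- Containing a vertex `v` of a leg costs the vertices from the major vertex `w` to `v`, one of
which is present anyway unless the leg is the only one at `w`. -/
lemma exists_mem_ncard_eq [Nontrivial V] (hT : T.IsTree) {l w v : V}
    (hl : IsTerminalVertexOf T l w) (hv : v ∈ leg T w l) :
    ∃ S, IsConnectedResolvingSet T S ∧ v ∈ S ∧
      ((∃ l', IsTerminalVertexOf T l' w ∧ l' ≠ l) →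
        S.ncard + 1 = (interiorSet T).ncard + numEndVertices T + T.dist v w) ∧
      ((∀ l', IsTerminalVertexOf T l' w → l' = l) →
        S.ncard = (interiorSet T).ncard + numEndVertices T + T.dist v w) := by
  classical
  have hM : ∃ w, IsMajor T w := ⟨w, hl.2.1⟩
  have hlE := mem_endVertices.2 hl.1
  obtain ⟨h, hle, hz, hsum, hnon, huni⟩ :=
    exists_sum_add_card_image_eq (endVertices T) (majorOf T) l
  have hpos := hT.1.pos_dist_of_ne hv.1.symm
  have hvl := hv.2
  unfold Betw at hvl
  have hup : ∀ x, Function.update h l (T.dist w v) x = 0 → h x = 0 := by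
    intro x hx
    by_cases hxl : x = l
    · subst hxl
      rw [Function.update_self] at hx
      omega
    · rwa [Function.update_of_ne hxl] at hx
  have hcard := ncard_prunedSet hT hM (h := Function.update h l (T.dist w v)) (by
    intro x hx
    by_cases hxl : x = l
    · subst hxl
      rw [Function.update_self, hl.majorOf_eq]
      omega
    · rw [Function.update_of_ne hxl]
      exact (hle x).trans (hT.1.pos_dist_of_ne (isTerminalVertexOf_majorOf hT hM hx).ne))
  rw [Finset.sum_update_of_mem hlE, ncard_trunk hT hM] at hcard
  rw [Finset.sum_eq_add_sum_sdiff_singleton_of_mem hlE, card_endVertices] at hsum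
  refine ⟨prunedSet T (Function.update h l (T.dist w v)),
    isConnectedResolvingSet_prunedSet hT hM fun w l l' hl hl' h0 h0' =>
      hz l (mem_endVertices.2 hl.1) l' (mem_endVertices.2 hl'.1) (hup _ h0) (hup _ h0')
        (hl.majorOf_eq.trans hl'.majorOf_eq.symm),
    (mem_prunedSet_of_mem_leg hT hl hv).2 (by rw [Function.update_self]), ?_, ?_⟩
  · rintro ⟨l', hl', hne⟩
    have := hnon ⟨l', mem_endVertices.2 hl'.1, hne, hl'.majorOf_eq.trans hl.majorOf_eq.symm⟩
    rw [T.dist_comm (u := v)]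
    omega
  · intro huniq
    have := huni hlE fun x hx hxl => huniq x (by
      have := isTerminalVertexOf_majorOf hT hM hx
      rwa [hxl, hl.majorOf_eq] at this)
    rw [T.dist_comm (u := v)]
    omega

end Counting

section Main

variable {V : Type*} {T : SimpleGraph V}

lemma cdim_eq {S : Set V} {n : ℕ} (hS : IsConnectedResolvingSet T S) (hn : S.ncard = n)
    (hmin : ∀ S', IsConnectedResolvingSet T S' → n ≤ S'.ncard) : cdim T = n :=
  le_antisymm (Nat.sInf_le ⟨S, hS, hn⟩)
    (le_csInf ⟨n, S, hS, hn⟩ (by rintro k ⟨S', hS', rfl⟩; exact hmin S' hS'))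

lemma cdimAt_eq {S : Set V} {v : V} {n : ℕ} (hS : IsConnectedResolvingSet T S) (hv : v ∈ S)
    (hn : S.ncard = n)
    (hmin : ∀ S', IsConnectedResolvingSet T S' → v ∈ S' → n ≤ S'.ncard) : cdimAt T v = n :=
  le_antisymm (Nat.sInf_le ⟨S, hS, hv, hn⟩)
    (le_csInf ⟨n, S, hS, hv, hn⟩ (by rintro k ⟨S', hS', hv', rfl⟩; exact hmin S' hS' hv'))

variable [Fintype V]

lemma IsConnectedResolvingSet.one_le_ncard {S : Set V} (hS : IsConnectedResolvingSet T S) :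
    1 ≤ S.ncard := by
  have := Set.nonempty_coe_sort.1 hS.2.nonempty
  exact (Set.ncard_pos (Set.toFinite _)).2 this

variable [DecidableRel T.Adj]

/-! ### Paths -/

/-- Without major vertices, the distance to an end vertex determines a vertex. -/
lemma dist_injective_of_isEndVertex (hT : T.IsTree) (hM : ¬ ∃ w, IsMajor T w) {v : V}
    (hv : IsEndVertex T v) : Function.Injective (T.dist v) := by
  intro x y h
  by_contra hxy
  obtain ⟨m, b, c, -, -, hb, hc, hbc, hm⟩ := exists_branching_isMajor hT hxy h
  rcases hm with rfl | hm
  · exact hbc (hv.adj_unique hb.1 hc.1)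
  · exact hM ⟨m, hm⟩

lemma isConnectedResolvingSet_singleton (hT : T.IsTree) (hM : ¬ ∃ w, IsMajor T w) {v : V}
    (hv : IsEndVertex T v) : IsConnectedResolvingSet T {v} := by
  refine ⟨fun x y hxy => ⟨v, rfl, fun h => hxy ?_⟩, (induce_connected_iff hT).2
    ⟨Set.singleton_nonempty v, ?_⟩⟩
  · refine dist_injective_of_isEndVertex hT hM hv ?_
    rwa [T.dist_comm, T.dist_comm (u := v)]
  · rintro x rfl y rfl z hz
    unfold Betw at hz
    rw [SimpleGraph.dist_self] at hz
    exact (hT.1.dist_eq_zero_iff.1 (by omega)).symm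

lemma isConnectedResolvingSet_pair (hT : T.IsTree) (hM : ¬ ∃ w, IsMajor T w) {v a : V}
    (ha : T.Adj v a) : IsConnectedResolvingSet T {v, a} := by
  refine ⟨fun x y hxy => ?_, induce_pair_connected_of_adj ha⟩
  by_contra hcon
  simp only [Resolves, not_exists, not_and, not_not, Set.mem_insert_iff, Set.mem_singleton_iff,
    forall_eq_or_imp, forall_eq] at hcon
  rw [T.dist_comm, T.dist_comm (u := y), T.dist_comm (u := x) (v := a),
    T.dist_comm (u := y) (v := a)] at hcon
  obtain ⟨m, b, c, -, -, hb, hc, hbc, hm⟩ := exists_branching_isMajor hT hxy hcon.1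
  rcases hm with rfl | hm
  · -- `a` is one of the two neighbours of `m` and so lies towards exactly one of `x` and `y`
    by_cases hab : a = b
    · subst hab
      have := dist_of_not_toward hT ha fun h => hbc (toward_unique hT h hc)
      have := hb.2
      omega
    · by_cases hac : a = c
      · subst hac
        have := dist_of_not_toward hT ha fun h => hbc (toward_unique hT hb h)
        have := hc.2
        omega
      · exact hM ⟨m, isMajor_of_adj ha hb.1 hc.1 hab hac hbc⟩
  · exact hM ⟨m, hm⟩

lemma IsConnectedResolvingSet.two_le_ncard [Nontrivial V] (hT : T.IsTree) {S : Set V}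
    (hS : IsConnectedResolvingSet T S) {v : V} (hv : ¬ IsEndVertex T v) (hvS : v ∈ S) :
    2 ≤ S.ncard := by
  by_contra hlt
  have hS1 : S = {v} := Set.eq_singleton_iff_unique_mem.2 ⟨hvS, fun x hx =>
    (Set.ncard_le_one (Set.toFinite _)).1 (by omega) x hx v hvS⟩
  have h2 : 2 ≤ T.degree v := by
    have := one_le_degree hT.1 v
    unfold IsEndVertex at hv
    omega
  obtain ⟨b, hb, -⟩ := exists_adj_ne_of_two_le_degree h2 v
  obtain ⟨c, hc, hcb⟩ := exists_adj_ne_of_two_le_degree h2 b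
  refine hcb (hS.eq_of_adj_of_notMem hT hvS hc hb ?_ ?_)
  · rw [hS1]
    exact hc.ne'
  · rw [hS1]
    exact hb.ne'

lemma isPathGraph_of_not_exists_isMajor [Nontrivial V] (hT : T.IsTree)
    (hM : ¬ ∃ w, IsMajor T w) : IsPathGraph T := by
  obtain ⟨v, hv⟩ := hT.exists_vert_degree_one_of_nontrivial
  have hinj := dist_injective_of_isEndVertex hT hM hv
  have hlt : ∀ x, T.dist v x < Fintype.card V := by
    intro x
    obtain ⟨p, hp, hpl⟩ := hT.1.exists_path_of_dist v x
    exact hpl ▸ hp.length_lt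
  have hbij : Function.Bijective fun x => (⟨T.dist v x, hlt x⟩ : Fin (Fintype.card V)) :=
    (Fintype.bijective_iff_injective_and_card _).2
      ⟨fun x y h => hinj (Fin.mk.inj h), (Fintype.card_fin _).symm⟩
  -- numbering the vertices by their distance to an end vertex is an isomorphism
  have key : ∀ x y, T.dist v x + 1 = T.dist v y → T.Adj x y := by
    intro x y h
    have hne : y ≠ v := by
      rintro rfl
      simp at h
    obtain ⟨a, ha⟩ := exists_toward hT.1 hne
    have h2 := ha.2
    rw [T.dist_comm, T.dist_comm (u := a)] at h2
    rw [hinj (show T.dist v x = T.dist v a by omega)]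
    exact ha.1.symm
  refine ⟨Fintype.card V, ⟨⟨Equiv.ofBijective _ hbij, ?_⟩⟩⟩
  intro x y
  simp only [Equiv.ofBijective_apply, pathGraph_adj]
  constructor
  · rintro (h | h)
    · exact key x y h
    · exact (key y x h).symm
  · intro h
    rcases hT.dist_eq_dist_add_one_of_adj v h with h | h
    · exact Or.inr h.symm
    · exact Or.inl h.symm

lemma IsPathGraph.not_exists_isMajor (h : IsPathGraph T) : ¬ ∃ w, IsMajor T w := by
  rintro ⟨w, hw⟩
  obtain ⟨n, ⟨e⟩⟩ := h
  obtain ⟨a, b, ha, hb, -, -, hab⟩ := exists_adj_ne_of_isMajor hw w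
  have key : ∀ c, T.Adj w c → c ≠ a → c ≠ b → False := by
    intro c hc hca hcb
    have h1 := pathGraph_adj.1 (e.map_adj_iff.2 ha)
    have h2 := pathGraph_adj.1 (e.map_adj_iff.2 hb)
    have h3 := pathGraph_adj.1 (e.map_adj_iff.2 hc)
    have n1 : (e a).val ≠ (e b).val := fun h => hab (e.injective (Fin.ext h))
    have n2 : (e c).val ≠ (e a).val := fun h => hca (e.injective (Fin.ext h))
    have n3 : (e c).val ≠ (e b).val := fun h => hcb (e.injective (Fin.ext h))
    omega
  obtain ⟨c, d, hc, hd, hca, hda, hcd⟩ := exists_adj_ne_of_isMajor hw a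
  by_cases hcb : c = b
  · exact key d hd hda fun h => hcd (hcb.trans h.symm)
  · exact key c hc hca hcb

/-! ### The exterior major vertices and the core -/

lemma exteriorMajor_nonempty_iff [Nontrivial V] (hT : T.IsTree) :
    (exteriorMajor T).Nonempty ↔ ∃ w, IsMajor T w := by
  refine ⟨fun ⟨w, hw⟩ => ⟨w, hw.1⟩, fun hM => ?_⟩
  obtain ⟨l, hl⟩ := hT.exists_vert_degree_one_of_nontrivial
  obtain ⟨w, hw⟩ := exists_isTerminalVertexOf hT hM hl
  exact ⟨w, hw.2.1, terminalDegree_pos_iff.2 ⟨l, hw⟩⟩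

lemma mem_legSet_iff (hT : T.IsTree) {w x : V} :
    x ∈ legSet T w ↔ x = w ∨ ∃ l, IsTerminalVertexOf T l w ∧ x ∈ leg T w l := by
  simp only [legSet, Set.mem_ofPred_eq, exists_isPath_mem_support_iff hT]
  constructor
  · rintro (h | ⟨l, hl, hx⟩)
    · exact Or.inl h
    · by_cases hxw : x = w
      · exact Or.inl hxw
      · exact Or.inr ⟨l, hl, hxw, hx⟩
  · rintro (h | ⟨l, hl, hx⟩)
    · exact Or.inl h
    · exact Or.inr ⟨l, hl, hx.2⟩

lemma IsTerminalVertexOf.mem_exteriorMajor {l w : V} (hl : IsTerminalVertexOf T l w) :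
    w ∈ exteriorMajorOne T ∨ w ∈ exteriorMajorTwo T := by
  have hpos := terminalDegree_pos_iff.2 ⟨l, hl⟩
  by_cases h1 : terminalDegree T w = 1
  · exact Or.inl ⟨⟨hl.2.1, hpos⟩, h1⟩
  · exact Or.inr ⟨⟨hl.2.1, hpos⟩, by omega⟩

lemma eq_of_mem_exteriorMajorOne {l w : V} (hw : w ∈ exteriorMajorOne T)
    (hl : IsTerminalVertexOf T l w) (l' : V) (hl' : IsTerminalVertexOf T l' w) : l' = l :=
  (Set.ncard_le_one (Set.toFinite _)).1 hw.2.le l' hl' l hl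

lemma exists_ne_of_mem_exteriorMajorTwo {w : V} (hw : w ∈ exteriorMajorTwo T) (l : V) :
    ∃ l', IsTerminalVertexOf T l' w ∧ l' ≠ l :=
  Set.exists_ne_of_one_lt_ncard hw.2 l

lemma mem_coreSet_of_mem_trunk (hT : T.IsTree) {x : V} (hx : x ∈ trunk T) : x ∈ coreSet T := by
  rcases hx with hx | hx
  · rcases Nat.eq_zero_or_pos (terminalDegree T x) with h | h
    · exact Or.inr (Or.inr ⟨hx, h⟩)
    · obtain ⟨l, hl⟩ := terminalDegree_pos_iff.1 h
      rcases hl.mem_exteriorMajor with h | h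
      · exact Or.inl (Or.inr h)
      · exact Or.inl (Or.inl ⟨x, h, Or.inl rfl, (mem_legSet_iff hT).2 (Or.inl rfl)⟩)
  · exact Or.inr (Or.inl hx)

lemma mem_coreSet_union_legs [Nontrivial V] (hT : T.IsTree) (hM : ∃ w, IsMajor T w) (v : V) :
    v ∈ coreSet T ∪ legsOne T ∪ legsTwo T := by
  rcases isMajor_or_interior_or_mem_leg hT hM v with h | h | ⟨l, w, hl, hv⟩
  · exact Or.inl (Or.inl (mem_coreSet_of_mem_trunk hT (Or.inl h)))
  · exact Or.inl (Or.inl (mem_coreSet_of_mem_trunk hT (Or.inr h)))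
  · have hvw : v ∈ legSet T w := (mem_legSet_iff hT).2 (Or.inr ⟨l, hl, hv⟩)
    rcases hl.mem_exteriorMajor with h | h
    · exact Or.inl (Or.inr ⟨w, h, hvw⟩)
    · exact Or.inr ⟨w, h, hvw⟩

lemma cdimAt_of_mem_coreSet [Nontrivial V] (hT : T.IsTree) (hM : ∃ w, IsMajor T w) {v : V}
    (hv : v ∈ coreSet T) : cdimAt T v = (interiorSet T).ncard + numEndVertices T := by
  have hcase : v ∈ trunk T ∨
      ∃ w ∈ exteriorMajorTwo T, T.Adj w v ∧ ∃ l, IsTerminalVertexOf T l w ∧ v ∈ leg T w l := by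
    rcases hv with (⟨w, hw, hv⟩ | hv) | hv
    · rcases hv with ⟨rfl | hadj, hleg⟩
      · exact Or.inl (Or.inl hw.1.1)
      · rcases (mem_legSet_iff hT).1 hleg with rfl | hl
        · exact absurd hadj (T.loopless.irrefl _)
        · exact Or.inr ⟨w, hw, hadj, hl⟩
    · exact Or.inl (Or.inl hv.1.1)
    · rcases hv with hv | hv
      · exact Or.inl (Or.inr hv)
      · exact Or.inl (Or.inl hv.1)
  rcases hcase with h | ⟨w, hw, hadj, l, hl, hvl⟩
  · obtain ⟨S, hS, hcard⟩ := exists_ncard_eq hT hM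
    exact cdimAt_eq hS (hS.trunk_subset hT hM h) hcard fun S' hS' _ => hS'.le_ncard hT hM
  · obtain ⟨S, hS, hvS, hcard, -⟩ := exists_mem_ncard_eq hT hl hvl
    have := hcard (exists_ne_of_mem_exteriorMajorTwo hw l)
    rw [dist_eq_one_of_adj hadj.symm] at this
    exact cdimAt_eq hS hvS (by omega) fun S' hS' _ => hS'.le_ncard hT hM

lemma cdimAt_of_mem_legsOne [Nontrivial V] (hT : T.IsTree) {v : V}
    (hv : v ∈ legsOne T \ coreSet T) : ∃ u, IsNearestMajor T v u ∧
      cdimAt T v = (interiorSet T).ncard + numEndVertices T + T.dist v u := by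
  obtain ⟨⟨w, hw, hleg⟩, hcore⟩ := hv
  rcases (mem_legSet_iff hT).1 hleg with rfl | ⟨l, hl, hvl⟩
  · exact absurd (mem_coreSet_of_mem_trunk hT (Or.inl hw.1.1)) hcore
  · obtain ⟨S, hS, hvS, -, hcard⟩ := exists_mem_ncard_eq hT hl hvl
    have huniq := eq_of_mem_exteriorMajorOne hw hl
    exact ⟨w, isNearestMajor_of_mem_leg hT hl hvl, cdimAt_eq hS hvS (hcard huniq)
      fun S' hS' hvS' => (hS'.le_ncard_of_mem_leg hT hl hvl hvS').2 huniq⟩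

lemma cdimAt_of_mem_legsTwo [Nontrivial V] (hT : T.IsTree) {v : V}
    (hv : v ∈ legsTwo T \ coreSet T) : ∃ u, IsNearestMajor T v u ∧
      cdimAt T v + 1 = (interiorSet T).ncard + numEndVertices T + T.dist v u := by
  obtain ⟨⟨w, hw, hleg⟩, hcore⟩ := hv
  rcases (mem_legSet_iff hT).1 hleg with rfl | ⟨l, hl, hvl⟩
  · exact absurd (mem_coreSet_of_mem_trunk hT (Or.inl hw.1.1)) hcore
  · obtain ⟨S, hS, hvS, hcard, -⟩ := exists_mem_ncard_eq hT hl hvl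
    have hS' := hcard (exists_ne_of_mem_exteriorMajorTwo hw l)
    refine ⟨w, isNearestMajor_of_mem_leg hT hl hvl, ?_⟩
    rw [cdimAt_eq hS hvS rfl fun S' hS' hvS' => ?_, hS']
    have := (hS'.le_ncard_of_mem_leg hT hl hvl hvS').1
    omega

end Main

end ConnMetricDim

/-- The connected metric dimension of a tree of order at least two, and its connected metric
dimension at each vertex. For trees with an exterior major vertex it is part of the claim that the
cases cover every vertex. -/
theorem mainTheorem4 {V : Type*} [Fintype V] [Nontrivial V]
    (T : SimpleGraph V) [DecidableRel T.Adj] (hT : T.IsTree) :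
    ((ConnMetricDim.IsPathGraph T → ConnMetricDim.cdim T = 1) ∧
      (¬ ConnMetricDim.IsPathGraph T →
        ConnMetricDim.cdim T =
          (ConnMetricDim.interiorSet T).ncard + ConnMetricDim.numEndVertices T)) ∧
    ∀ v : V,
      (ConnMetricDim.exteriorMajor T = ∅ →
        (ConnMetricDim.IsEndVertex T v → ConnMetricDim.cdimAt T v = 1) ∧
        (¬ ConnMetricDim.IsEndVertex T v → ConnMetricDim.cdimAt T v = 2)) ∧
      ((ConnMetricDim.exteriorMajor T).Nonempty →
        (v ∈ ConnMetricDim.coreSet T ∪ ConnMetricDim.legsOne T ∪ ConnMetricDim.legsTwo T) ∧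
        (v ∈ ConnMetricDim.coreSet T →
          ConnMetricDim.cdimAt T v =
            (ConnMetricDim.interiorSet T).ncard + ConnMetricDim.numEndVertices T) ∧
        (v ∈ ConnMetricDim.legsOne T \ ConnMetricDim.coreSet T →
          ∃ u, ConnMetricDim.IsNearestMajor T v u ∧
            ConnMetricDim.cdimAt T v =
              (ConnMetricDim.interiorSet T).ncard + ConnMetricDim.numEndVertices T
                + T.dist v u) ∧
        (v ∈ ConnMetricDim.legsTwo T \ ConnMetricDim.coreSet T →
          ∃ u, ConnMetricDim.IsNearestMajor T v u ∧
            ConnMetricDim.cdimAt T v + 1 =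
              (ConnMetricDim.interiorSet T).ncard + ConnMetricDim.numEndVertices T
                + T.dist v u)) := by
  open ConnMetricDim in
  refine ⟨⟨fun hP => ?_, fun hP => ?_⟩, fun v => ⟨fun hE => ?_, fun hE => ?_⟩⟩
  · have hM := hP.not_exists_isMajor
    obtain ⟨v, hv⟩ := hT.exists_vert_degree_one_of_nontrivial
    exact cdim_eq (isConnectedResolvingSet_singleton hT hM hv) (Set.ncard_singleton v)
      fun S hS => hS.one_le_ncard
  · have hM : ∃ w, IsMajor T w := by
      by_contra hM
      exact hP (isPathGraph_of_not_exists_isMajor hT hM)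
    obtain ⟨S, hS, hcard⟩ := exists_ncard_eq hT hM
    exact cdim_eq hS hcard fun S' hS' => hS'.le_ncard hT hM
  · have hM : ¬ ∃ w, IsMajor T w := by
      rw [← exteriorMajor_nonempty_iff hT, hE]
      exact Set.not_nonempty_empty
    refine ⟨fun hv => ?_, fun hv => ?_⟩
    · exact cdimAt_eq (isConnectedResolvingSet_singleton hT hM hv) rfl (Set.ncard_singleton v)
        fun S hS _ => hS.one_le_ncard
    · obtain ⟨a, ha⟩ := (T.degree_pos_iff_exists_adj v).1 (one_le_degree hT.1 v)
      exact cdimAt_eq (isConnectedResolvingSet_pair hT hM ha) (Set.mem_insert v {a})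
        (Set.ncard_pair ha.ne) fun S hS hvS => hS.two_le_ncard hT hv hvS
  · have hM := (exteriorMajor_nonempty_iff hT).1 hE
    exact ⟨mem_coreSet_union_legs hT hM v, cdimAt_of_mem_coreSet hT hM,
      cdimAt_of_mem_legsOne hT, cdimAt_of_mem_legsTwo hT⟩
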